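/- Let $q$ be a power of an odd prime, let $\mathbb{F}_q$ be the field with $q$ elements and $\overline{\mathbb{F}_q}$ an algebraic closure of it. Let $u_0,u_1,u_2,\ldots$ be independent variables and, for $n\ge 1$, put $f_n=u_nX^n+\cdots+u_1X+u_0$. Let $\mathrm{Disc}(f_n)\in\mathbb{F}_q[u_0,\ldots,u_n]$ be the discriminant of $f_n$ with respect to $X$, regarded as a polynomial of degree $n$ with indeterminate coefficients. Then for any $\nu\ge 1$ and any integers $2\le n_1<\cdots<n_\nu$, the multivariate polynomial $$D_{n_1,\ldots,n_\nu}=\prod_{j=1}^{\nu}\mathrm{Disc}(f_{n_j})$$ is not the square of a polynomial in $\mathbb{F}_q[u_0,u_1,\ldots,u_{n_\nu}]$, nor of a polynomial in $\overline{\mathbb{F}_q}[u_0,u_1,\ldots,u_{n_\nu}]$. -/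

import Mathlib

/-- The generic polynomial `f_m = u_m X^m + ⋯ + u_1 X + u_0` (for `m ≤ N`), whose coefficients are
the variables `u_0, …, u_N` of the polynomial ring `F[u_0, …, u_N]`. -/
noncomputable def genericPoly (F : Type*) [Field F] (N m : ℕ) :
    Polynomial (MvPolynomial (Fin (N + 1)) F) :=
  ∑ i ∈ Finset.univ.filter (fun i : Fin (N + 1) => i.val ≤ m),
    Polynomial.C (MvPolynomial.X i) * Polynomial.X ^ i.val

/-- `D_{n_1, …, n_ν} = ∏_j Disc(f_{n_j})`, an element of `F[u_0, …, u_N]`.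
Here `Polynomial.discr` is the usual discriminant `(-1)^(m(m-1)/2) u_m⁻¹ Res(f_m, f_m')`, with
`f_m'` taken in formal degree `m - 1`. -/
noncomputable def discProd (F : Type*) [Field F] (N : ℕ) {ν : ℕ} (n : Fin ν → ℕ) :
    MvPolynomial (Fin (N + 1)) F :=
  ∏ j, (genericPoly F N (n j)).discr

/-! With `N` the largest degree, `Disc(f_N)` vanishes to order exactly one along a suitable line on
which the smaller discriminants stay nonzero. Specialise to `DualNumber K`: `u_N ↦ ε`, `u_(N-1) ↦
0`, and lower `u_i ↦ c_i` with every truncation of `c` separable (`exists_separable_ofCoeffs`). The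
product becomes a nonzero multiple of `ε`, whereas a square with zero constant part is zero. The
order is read off from `u_0 Disc(f_m) = ± Res(f_m, X f_m' - m f_m)`, whose second argument has top
coefficient `-u_(m-1)` in degree `m - 1`. For `m = N` this coefficient dies, so the resultant
acquires one factor `u_N = ε`. -/

open Polynomial

/-! ### Discriminants through the resultant of `f` and `X f' - m f`. -/

namespace Polynomial

/-- The combination `X f' - m f`, in which the coefficient of `X ^ m` cancels. -/
noncomputable def eulerDefect {R : Type*} [CommRing R] (f : R[X]) (m : ℕ) : R[X] :=
  X * derivative f - C (m : R) * f

lemma coeff_eulerDefect {R : Type*} [CommRing R] (f : R[X]) (m k : ℕ) :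
    (eulerDefect f m).coeff k = ((k : R) - m) * f.coeff k := by
  cases k with
  | zero => simp [eulerDefect]
  | succ k => simp [eulerDefect, coeff_X_mul, coeff_derivative]; ring

lemma map_eulerDefect {R S : Type*} [CommRing R] [CommRing S] (φ : R →+* S) (f : R[X]) (m : ℕ) :
    (eulerDefect f m).map φ = eulerDefect (f.map φ) m := by
  simp [eulerDefect, derivative_map]

lemma natDegree_eulerDefect_le {R : Type*} [CommRing R] {f : R[X]} {m : ℕ}
    (hf : f.natDegree ≤ m) : (eulerDefect f m).natDegree ≤ m - 1 := by
  rw [natDegree_le_iff_coeff_eq_zero]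
  intro k hk
  rw [coeff_eulerDefect]
  obtain rfl | hkm := eq_or_ne k m
  · rw [sub_self, zero_mul]
  · rw [coeff_eq_zero_of_natDegree_lt (by lia), mul_zero]

/-- The resultant of `f` and `X f' - m f` is, up to sign, `f(0) Disc(f)`. -/
lemma resultant_eulerDefect {R : Type*} [CommRing R] [IsDomain R] {f : R[X]}
    (hf : 0 < f.natDegree) :
    resultant f (eulerDefect f f.natDegree) f.natDegree (f.natDegree - 1) =
      (-1) ^ (f.natDegree + f.natDegree * (f.natDegree - 1) / 2) * f.coeff 0 * f.discr := by
  set m := f.natDegree with hm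
  have hlead : f.coeff m ≠ 0 := by
    rw [hm, coeff_natDegree, leadingCoeff_ne_zero]
    exact ne_zero_of_natDegree_gt hf
  have hder : (derivative f).natDegree ≤ m - 1 := natDegree_derivative_le f
  have h1 : resultant f (eulerDefect f m) m m =
      f.coeff m * resultant f (eulerDefect f m) m (m - 1) := by
    have := resultant_add_right_deg f (eulerDefect f m) m (m - 1) 1
      (natDegree_eulerDefect_le hm.symm.le)
    rwa [Nat.sub_add_cancel hf, pow_one] at this
  have h2 : resultant f (eulerDefect f m) m m = resultant f (X * derivative f) m m := by
    have := resultant_add_mul_right f (X * derivative f) (-C (m : R)) m m (by simp) hm.symm.le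
    rw [← this, eulerDefect]
    congr 1
    ring
  have h3 : resultant f (X * derivative f) m m =
      (-1) ^ m * f.coeff 0 * resultant f (derivative f) m (m - 1) := by
    -- In positive characteristic `f'` may have degree below `m - 1`; `k` measures the drop.
    obtain ⟨k, hk⟩ := Nat.exists_eq_add_of_le hder
    have hX := resultant_X_pow_right f m 1 hm.symm.le
    have hmul := resultant_mul_right f X (derivative f) m hm.symm.le
    have hle : (X * derivative f).natDegree ≤ 1 + (derivative f).natDegree :=
      natDegree_mul_le_of_le natDegree_X_le le_rfl
    have hadd := resultant_add_right_deg f (X * derivative f) m _ k hle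
    rw [natDegree_X] at hmul
    rw [show 1 + (derivative f).natDegree + k = m by lia, hmul] at hadd
    rw [hadd, hk, resultant_add_right_deg f (derivative f) m _ k le_rfl]
    rw [pow_one, mul_one, pow_one] at hX
    rw [hX]
    ring
  have h4 := resultant_deriv (natDegree_pos_iff_degree_pos.mp hf)
  rw [← hm, ← coeff_natDegree, ← hm] at h4
  apply mul_left_cancel₀ hlead
  rw [← h1, h2, h3, h4, pow_add]
  ring

/-- Modulo `g` the defect is `X g'`, and both factors are coprime to `g`. -/
lemma isCoprime_eulerDefect {K : Type*} [Field K] {g : K[X]} (hg : g.Separable)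
    (h0 : g.coeff 0 ≠ 0) (m : ℕ) : IsCoprime g (eulerDefect g m) := by
  have hX : IsCoprime g X := by
    refine ((irreducible_X (R := K)).coprime_iff_not_dvd.mpr ?_).symm
    rwa [X_dvd_iff]
  have := (hX.mul_right hg).add_mul_left_right (-C (m : K))
  rwa [eulerDefect, sub_eq_add_neg, ← neg_mul, mul_comm (-C (m : K))]

/-- Since `d` is the true degree of the defect, overstating the degree of `g` only contributes a
sign and a power of a nonzero leading coefficient. -/
lemma resultant_eulerDefect_ne_zero {K : Type*} [Field K] {g : K[X]} (hg : g.Separable)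
    (h0 : g.coeff 0 ≠ 0) {m d : ℕ} (hd : (eulerDefect g m).natDegree ≤ d)
    (hd' : (eulerDefect g m).coeff d ≠ 0) {n : ℕ} (hn : g.natDegree ≤ n) :
    resultant g (eulerDefect g m) n d ≠ 0 := by
  obtain ⟨k, rfl⟩ := Nat.exists_eq_add_of_le hn
  obtain rfl : (eulerDefect g m).natDegree = d := hd.antisymm (le_natDegree_of_ne_zero hd')
  rw [resultant_add_left_deg _ _ _ _ _ le_rfl]
  exact mul_ne_zero (mul_ne_zero (pow_ne_zero _ (by simp)) (pow_ne_zero _ hd'))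
    (resultant_ne_zero _ _ (isCoprime_eulerDefect hg h0 m))

/-! ### Coefficient sequences with separable truncations. -/

/-- The polynomial `c_m X^m + ⋯ + c_1 X + c_0`. -/
noncomputable def ofCoeffs {R : Type*} [CommRing R] (c : ℕ → R) (m : ℕ) : R[X] :=
  ∑ i ∈ Finset.range (m + 1), C (c i) * X ^ i

lemma coeff_ofCoeffs {R : Type*} [CommRing R] (c : ℕ → R) (m k : ℕ) :
    (ofCoeffs c m).coeff k = if k ≤ m then c k else 0 := by
  simp [ofCoeffs, finsetSum_coeff, coeff_C_mul, coeff_X_pow]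

lemma natDegree_ofCoeffs_le {R : Type*} [CommRing R] (c : ℕ → R) (m : ℕ) :
    (ofCoeffs c m).natDegree ≤ m := by
  rw [natDegree_le_iff_coeff_eq_zero]
  intro k hk
  rw [coeff_ofCoeffs, if_neg (by lia)]

lemma natDegree_ofCoeffs {R : Type*} [CommRing R] (c : ℕ → R) (m : ℕ) (h : c m ≠ 0) :
    (ofCoeffs c m).natDegree = m :=
  (natDegree_ofCoeffs_le c m).antisymm
    (le_natDegree_of_ne_zero (by rwa [coeff_ofCoeffs, if_pos le_rfl]))

lemma map_ofCoeffs {R S : Type*} [CommRing R] [CommRing S] (φ : R →+* S) (c : ℕ → R) (m : ℕ) :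
    (ofCoeffs c m).map φ = ofCoeffs (fun i ↦ φ (c i)) m := by
  simp [ofCoeffs, Polynomial.map_sum]

lemma ofCoeffs_congr {R : Type*} [CommRing R] {c d : ℕ → R} {m : ℕ}
    (h : ∀ i ≤ m, c i = d i) : ofCoeffs c m = ofCoeffs d m := by
  ext k
  rw [coeff_ofCoeffs, coeff_ofCoeffs]
  split_ifs with hk
  exacts [h k hk, rfl]

lemma ofCoeffs_succ {R : Type*} [CommRing R] (c : ℕ → R) (m : ℕ) :
    ofCoeffs c (m + 1) = ofCoeffs c m + C (c (m + 1)) * X ^ (m + 1) := by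
  rw [ofCoeffs, Finset.sum_range_succ, ← ofCoeffs]

/-- Over an algebraically closed field, a polynomial of degree `n` not vanishing at `0` becomes
separable after adding a suitable nonzero multiple of `X ^ (n + 1)`. -/
lemma exists_separable_add_C_mul_X_pow {K : Type*} [Field K] [IsAlgClosed K] (g : K[X]) (n : ℕ)
    (h0 : g.coeff 0 ≠ 0) (hn : g.coeff n ≠ 0) :
    ∃ u : K, u ≠ 0 ∧ (g + C u * X ^ (n + 1)).Separable := by
  classical
  have hh : eulerDefect g (n + 1) ≠ 0 := by
    intro h
    have := coeff_eulerDefect g (n + 1) n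
    rw [h, coeff_zero] at this
    push_cast at this
    rw [show (n : K) - (n + 1) = -1 by ring] at this
    exact hn (by simpa using this)
  -- A double root `a` of `g + u X^(n+1)` is a root of the defect of `g`, which does not involve
  -- `u`, and `a` determines `u`. So only finitely many `u` are bad.
  obtain ⟨u, hu⟩ := Infinite.exists_notMem_finset
    (insert 0 ((eulerDefect g (n + 1)).roots.toFinset.image
      fun a ↦ -(g.eval a / a ^ (n + 1))))
  rw [Finset.mem_insert, not_or] at hu
  refine ⟨u, hu.1, ?_⟩
  rw [Separable, isCoprime_iff_aeval_ne_zero_of_isAlgClosed K K]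
  intro a
  by_contra! h
  obtain ⟨h1, h2⟩ := h
  simp only [map_add, map_mul, aeval_C, map_pow, aeval_X, Algebra.algebraMap_self,
    RingHom.id_apply, derivative_C_mul, derivative_X_pow, coe_aeval_eq_eval] at h1 h2
  have ha : a ≠ 0 := by
    rintro rfl
    rw [← coeff_zero_eq_eval_zero] at h1
    exact h0 (by simpa using h1)
  apply hu.2
  rw [Finset.mem_image]
  refine ⟨a, ?_, ?_⟩
  · rw [Multiset.mem_toFinset, mem_roots hh, IsRoot, eulerDefect]
    simp only [eval_sub, eval_mul, eval_X, eval_C]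
    simp only [Nat.add_sub_cancel] at h2
    linear_combination a * h2 - ((n + 1 : ℕ) : K) * h1
  · have := pow_ne_zero (n + 1) ha
    field_simp
    linear_combination -h1

lemma exists_separable_ofCoeffs {K : Type*} [Field K] [IsAlgClosed K] (n : ℕ) :
    ∃ c : ℕ → K, ∀ m ≤ n, c m ≠ 0 ∧ (ofCoeffs c m).Separable := by
  induction n with
  | zero =>
    refine ⟨fun _ ↦ 1, fun m hm ↦ ?_⟩
    obtain rfl : m = 0 := by lia
    simp [ofCoeffs]
  | succ n ih =>
    obtain ⟨c, hc⟩ := ih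
    obtain ⟨u, hu, hsep⟩ := exists_separable_add_C_mul_X_pow (ofCoeffs c n) n
      (by simpa [coeff_ofCoeffs] using (hc 0 (by lia)).1)
      (by simpa [coeff_ofCoeffs] using (hc n le_rfl).1)
    have hcongr : ∀ m ≤ n, ofCoeffs (Function.update c (n + 1) u) m = ofCoeffs c m :=
      fun m hm ↦ ofCoeffs_congr fun i hi ↦ Function.update_of_ne (by lia) _ _
    refine ⟨Function.update c (n + 1) u, fun m hm ↦ ?_⟩
    obtain rfl | hmn := eq_or_ne m (n + 1)
    · rw [ofCoeffs_succ, hcongr n le_rfl, Function.update_self]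
      exact ⟨hu, hsep⟩
    · rw [hcongr m (by lia), Function.update_of_ne hmn]
      exact hc m (by lia)

end Polynomial

/-! ### Specialising the generic discriminants. -/

lemma genericPoly_eq_ofCoeffs (F : Type*) [Field F] {N m : ℕ} (hm : m ≤ N) :
    genericPoly F N m =
      ofCoeffs (fun i ↦ if h : i < N + 1 then MvPolynomial.X ⟨i, h⟩ else 0) m := by
  ext1 k
  rw [coeff_ofCoeffs, genericPoly, finsetSum_coeff, Finset.sum_filter]
  simp only [coeff_C_mul, coeff_X_pow, mul_ite, mul_one, mul_zero]
  by_cases hk : k ≤ m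
  · rw [if_pos hk, dif_pos (by lia), Finset.sum_eq_single ⟨k, by lia⟩]
    · simp [hk]
    · intro i _ hi
      rw [if_neg (c := k = (i : ℕ)) (by rintro rfl; exact hi rfl), ite_self]
    · simp
  · rw [if_neg hk]
    refine Finset.sum_eq_zero fun i _ ↦ ?_
    split_ifs <;> first | rfl | lia

lemma natDegree_genericPoly (F : Type*) [Field F] {N m : ℕ} (hm : m ≤ N) :
    (genericPoly F N m).natDegree = m := by
  rw [genericPoly_eq_ofCoeffs F hm]
  apply natDegree_ofCoeffs
  rw [dif_pos (by lia)]
  exact MvPolynomial.X_ne_zero _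

/-- The image of `u_0 Disc(f_m)` under a specialisation `u_i ↦ w_i`. -/
lemma resultant_eulerDefect_specialization {F S : Type*} [Field F] [CommRing S] {N m : ℕ}
    (hm0 : 0 < m) (hm : m ≤ N) (φ : MvPolynomial (Fin (N + 1)) F →+* S) (w : ℕ → S)
    (hφ : ∀ i : Fin (N + 1), φ (MvPolynomial.X i) = w i) :
    resultant (ofCoeffs w m) (eulerDefect (ofCoeffs w m) m) m (m - 1) =
      (-1) ^ (m + m * (m - 1) / 2) * w 0 * φ (genericPoly F N m).discr := by
  have hdeg := natDegree_genericPoly F hm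
  have hmap : (genericPoly F N m).map φ = ofCoeffs w m := by
    rw [genericPoly_eq_ofCoeffs F hm, map_ofCoeffs]
    refine ofCoeffs_congr fun i hi ↦ ?_
    rw [dif_pos (by lia), hφ]
  have h0 : φ ((genericPoly F N m).coeff 0) = w 0 := by
    rw [← coeff_map, hmap, coeff_ofCoeffs, if_pos (by lia)]
  have key := congrArg φ (resultant_eulerDefect (f := genericPoly F N m) (by lia))
  rw [hdeg, ← resultant_map_map, map_eulerDefect, hmap] at key
  simpa [h0] using key

/-- Over a field of characteristic not two, the discriminants with `m < N` stay nonzero when the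
two top coefficients are specialised to zero and the others to a generic tuple. -/
lemma specialization_discr_ne_zero {K : Type*} [Field K] {N m : ℕ} (hm2 : 2 ≤ m) (hm : m < N)
    {c : ℕ → K} (hc : ∀ k ≤ N - 2, c k ≠ 0 ∧ (ofCoeffs c k).Separable)
    (φ : MvPolynomial (Fin (N + 1)) K →+* K)
    (hφ : ∀ i : Fin (N + 1), φ (MvPolynomial.X i) = if (i : ℕ) ≤ N - 2 then c i else 0) :
    φ (genericPoly K N m).discr ≠ 0 := by
  intro hzero
  have key := resultant_eulerDefect_specialization (by lia) hm.le φ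
    (fun i ↦ if i ≤ N - 2 then c i else 0) hφ
  rw [hzero, mul_zero] at key
  have htrunc : ofCoeffs (fun i ↦ if i ≤ N - 2 then c i else 0) m =
      ofCoeffs c (min m (N - 2)) := by
    ext k
    simp only [coeff_ofCoeffs, le_min_iff]
    split_ifs <;> first | rfl | lia
  rw [htrunc] at key
  refine resultant_eulerDefect_ne_zero (hc _ (by lia)).2 ?_ ?_ ?_ ?_ key
  · rw [coeff_ofCoeffs, if_pos (by lia)]
    exact (hc 0 (by lia)).1
  · exact natDegree_eulerDefect_le ((natDegree_ofCoeffs_le _ _).trans (by lia))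
  -- The coefficient is `((m - 1) - m) c_(m-1) = -c_(m-1)`.
  · rw [coeff_eulerDefect, coeff_ofCoeffs, if_pos (by lia), Nat.cast_sub (by lia)]
    exact mul_ne_zero (by simp) (hc _ (by lia)).1
  · exact (natDegree_ofCoeffs_le _ _).trans (by lia)

/-- Specialising the top two coefficients to `0` and `ε` makes the discriminant a nonzero
multiple of `ε`. -/
lemma specialization_discr_dualNumber {K : Type*} [Field K] (h2 : (2 : K) ≠ 0) {N : ℕ}
    (hN : 2 ≤ N) {c : ℕ → K} (hc : ∀ k ≤ N - 2, c k ≠ 0 ∧ (ofCoeffs c k).Separable)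
    (φ : MvPolynomial (Fin (N + 1)) K →+* DualNumber K)
    (hφ : ∀ i : Fin (N + 1), φ (MvPolynomial.X i) =
      if (i : ℕ) ≤ N - 2 then TrivSqZeroExt.inl (c i) else if (i : ℕ) = N then DualNumber.eps
        else 0) :
    TrivSqZeroExt.fst (φ (genericPoly K N N).discr) = 0 ∧
      TrivSqZeroExt.snd (φ (genericPoly K N N).discr) ≠ 0 := by
  set w : ℕ → DualNumber K := fun i ↦
    if i ≤ N - 2 then TrivSqZeroExt.inl (c i) else if i = N then DualNumber.eps else 0 with hw
  have key := resultant_eulerDefect_specialization (by lia) le_rfl φ w hφ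
  set f := ofCoeffs w N with hf
  have hfN : f.coeff N = DualNumber.eps := by
    rw [hf, coeff_ofCoeffs, if_pos le_rfl]
    exact (if_neg (by lia)).trans (if_pos rfl)
  have hdeg : (eulerDefect f N).natDegree ≤ N - 2 := by
    rw [natDegree_le_iff_coeff_eq_zero]
    intro k hk
    rw [coeff_eulerDefect, hf, coeff_ofCoeffs]
    obtain rfl | hkN := eq_or_ne k N
    · rw [sub_self, zero_mul]
    · rw [show w k = 0 from (if_neg (by lia)).trans (if_neg hkN), ite_self, mul_zero]
  -- Lowering the formal degree from `N - 1` to `N - 2` extracts the single factor `ε`.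
  have hstep := resultant_add_right_deg f (eulerDefect f N) N (N - 2) 1 hdeg
  rw [show N - 2 + 1 = N - 1 by lia, hfN, pow_one, key] at hstep
  have hfst : f.map (TrivSqZeroExt.fstHom K K K).toRingHom = ofCoeffs c (N - 2) := by
    rw [hf, map_ofCoeffs]
    ext k
    rw [coeff_ofCoeffs, coeff_ofCoeffs]
    change (if k ≤ N then TrivSqZeroExt.fst (w k) else 0) = _
    simp only [hw]
    split_ifs <;> first | lia | simp
  have hr : TrivSqZeroExt.fst (resultant f (eulerDefect f N) N (N - 2)) ≠ 0 := by
    have := resultant_map_map f (eulerDefect f N) N (N - 2) (TrivSqZeroExt.fstHom K K K).toRingHom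
    rw [map_eulerDefect, hfst] at this
    change (TrivSqZeroExt.fstHom K K K).toRingHom _ ≠ 0
    rw [← this]
    refine resultant_eulerDefect_ne_zero (hc _ le_rfl).2 ?_ ?_ ?_ ?_
    · rw [coeff_ofCoeffs, if_pos (by lia)]
      exact (hc 0 (by lia)).1
    · rw [← hfst, ← map_eulerDefect]
      exact natDegree_map_le.trans hdeg
    -- The coefficient is `((N - 2) - N) c_(N-2) = -2 c_(N-2)`, hence the need for odd
    -- characteristic.
    · rw [coeff_eulerDefect, coeff_ofCoeffs, if_pos le_rfl, Nat.cast_sub hN]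
      exact mul_ne_zero (by simpa using h2) (hc _ le_rfl).1
    · exact (natDegree_ofCoeffs_le _ _).trans (by lia)
  have hw0 : w 0 = TrivSqZeroExt.inl (c 0) := by simp [hw]
  have hc0 := (hc 0 (by lia)).1
  rw [hw0] at hstep
  generalize φ (genericPoly K N N).discr = d at hstep
  generalize resultant f (eulerDefect f N) N (N - 2) = r at hstep hr
  have hsgn : ∀ k : ℕ, ((-1) ^ k : DualNumber K) = 1 ∨ ((-1) ^ k : DualNumber K) = -1 :=
    neg_one_pow_eq_or _
  have e1 := congrArg TrivSqZeroExt.fst hstep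
  have e2 := congrArg TrivSqZeroExt.snd hstep
  obtain hs | hs := hsgn (N + N * (N - 1) / 2)
  all_goals
    rw [hs] at e1 e2
    simp [hc0] at e1 e2
    refine ⟨e1, fun h ↦ hr ?_⟩
    simpa [h, e1] using e2.symm

/-! ### Non-squareness, and descent to the finite field. -/

lemma not_isSquare_discProd_of_isAlgClosed {K : Type*} [Field K] [IsAlgClosed K]
    (h2 : (2 : K) ≠ 0) {ν : ℕ} {n : Fin ν → ℕ} (hn2 : ∀ j, 2 ≤ n j) (j₀ : Fin ν)
    (hlt : ∀ j ≠ j₀, n j < n j₀) : ¬ IsSquare (discProd K (n j₀) n) := by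
  classical
  set N := n j₀ with hN
  rintro ⟨S, hS⟩
  obtain ⟨c, hc⟩ := exists_separable_ofCoeffs (K := K) (N - 2)
  let w : ℕ → DualNumber K := fun i ↦
    if i ≤ N - 2 then TrivSqZeroExt.inl (c i) else if i = N then DualNumber.eps else 0
  let φ : MvPolynomial (Fin (N + 1)) K →+* DualNumber K :=
    MvPolynomial.eval₂Hom (TrivSqZeroExt.inlHom K K) (fun i ↦ w i)
  have hφ : ∀ i : Fin (N + 1), φ (MvPolynomial.X i) = w i := fun i ↦ by simp [φ]
  let ψ : MvPolynomial (Fin (N + 1)) K →+* K := (TrivSqZeroExt.fstHom K K K).toRingHom.comp φ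
  have hψ : ∀ i : Fin (N + 1), ψ (MvPolynomial.X i) = if (i : ℕ) ≤ N - 2 then c i else 0 := by
    intro i
    change TrivSqZeroExt.fst (φ (MvPolynomial.X i)) = _
    rw [hφ]
    simp only [w]
    split_ifs <;> simp
  obtain ⟨hd0, hd1⟩ := specialization_discr_dualNumber h2 (hn2 j₀) hc φ hφ
  have hE : ψ (∏ j ∈ Finset.univ.erase j₀, (genericPoly K N (n j)).discr) ≠ 0 := by
    rw [map_prod, Finset.prod_ne_zero_iff]
    intro j hj
    exact specialization_discr_ne_zero (hn2 j) (hlt j (Finset.ne_of_mem_erase hj)) hc ψ hψ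
  have hD := congrArg φ hS
  rw [discProd, ← Finset.mul_prod_erase _ _ (Finset.mem_univ j₀), map_mul, map_mul] at hD
  change TrivSqZeroExt.fst (φ _) ≠ 0 at hE
  have e1 := congrArg TrivSqZeroExt.fst hD
  have e2 := congrArg TrivSqZeroExt.snd hD
  rw [TrivSqZeroExt.fst_mul, TrivSqZeroExt.fst_mul, ← hN, hd0, zero_mul, eq_comm,
    mul_self_eq_zero] at e1
  rw [DualNumber.snd_mul, DualNumber.snd_mul, ← hN, hd0, e1] at e2
  simp only [zero_mul, mul_zero, add_zero, zero_add] at e2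
  exact mul_ne_zero hd1 hE e2

/-- Resultants commute with base change, so `± u_0 Disc` does too, and `u_0` cancels. -/
lemma map_discProd {F K : Type*} [Field F] [Field K] (σ : F →+* K) {N ν : ℕ} {n : Fin ν → ℕ}
    (hn0 : ∀ j, 0 < n j) (hn : ∀ j, n j ≤ N) :
    MvPolynomial.map σ (discProd F N n) = discProd K N n := by
  rw [discProd, map_prod, discProd]
  refine Finset.prod_congr rfl fun j _ ↦ ?_
  let w : ℕ → MvPolynomial (Fin (N + 1)) K :=
    fun i ↦ if h : i < N + 1 then MvPolynomial.X ⟨i, h⟩ else 0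
  have hw : ∀ i : Fin (N + 1), w i = MvPolynomial.X i := fun i ↦ dif_pos i.isLt
  have h1 := resultant_eulerDefect_specialization (hn0 j) (hn j)
    (MvPolynomial.map σ) w (fun i ↦ by rw [MvPolynomial.map_X, hw])
  have h2 := resultant_eulerDefect_specialization (hn0 j) (hn j)
    (RingHom.id (MvPolynomial (Fin (N + 1)) K)) w (fun i ↦ (hw i).symm)
  rw [h1] at h2
  refine mul_left_cancel₀ (mul_ne_zero (pow_ne_zero _ (by simp)) ?_) h2
  rw [show w 0 = MvPolynomial.X 0 from hw 0]
  exact MvPolynomial.X_ne_zero _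

theorem lemma5p2 {F : Type*} [Field F] [Finite F] (hq : Odd (Nat.card F))
    (ν : ℕ) (hν : 1 ≤ ν) (n : Fin ν → ℕ) (hn : StrictMono n) (hn2 : ∀ j, 2 ≤ n j)
    (N : ℕ) (hN : N = n ⟨ν - 1, Nat.sub_lt hν Nat.one_pos⟩) :
    ¬ IsSquare (discProd F N n) ∧
      ¬ IsSquare (MvPolynomial.map (algebraMap F (AlgebraicClosure F)) (discProd F N n)) := by
  have h2F : (2 : F) ≠ 0 := by
    have := Fintype.ofFinite F
    rw [Nat.card_eq_fintype_card] at hq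
    refine Ring.two_ne_zero fun h ↦ ?_
    exact Nat.not_even_iff_odd.mpr hq (Nat.even_iff.mpr (FiniteField.even_card_of_char_two h))
  have h2 : (2 : AlgebraicClosure F) ≠ 0 := by
    rw [← map_ofNat (algebraMap F (AlgebraicClosure F)) 2]
    exact (_root_.map_ne_zero _).mpr h2F
  have hlt : ∀ j ≠ (⟨ν - 1, Nat.sub_lt hν Nat.one_pos⟩ : Fin ν),
      n j < n ⟨ν - 1, Nat.sub_lt hν Nat.one_pos⟩ := by
    intro j hj
    refine hn (lt_of_le_of_ne ?_ hj)
    rw [Fin.le_def]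
    have := j.isLt
    simp only
    lia
  have hle : ∀ j, n j ≤ N := by
    intro j
    rw [hN]
    obtain rfl | hj := eq_or_ne j ⟨ν - 1, Nat.sub_lt hν Nat.one_pos⟩
    exacts [le_rfl, (hlt j hj).le]
  have main : ¬ IsSquare
      (MvPolynomial.map (algebraMap F (AlgebraicClosure F)) (discProd F N n)) := by
    rw [map_discProd _ (fun j ↦ by have := hn2 j; lia) hle, hN]
    exact not_isSquare_discProd_of_isAlgClosed h2 hn2 _ hlt
  exact ⟨fun h ↦ main (h.map _), main⟩
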